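/- **Soundness of BMDP abstractions.** *Controlled Markov systems.* A controlled Markov system $(\mathcal X,\mathcal U,\{[\![\Theta^u]\!]\}_{u\in\mathcal U},\mathrm{AP},L)$ consists of a state space $\mathcal X=\mathcal W\cup\Delta$ (working space $\mathcal W$, out-of-domain states $\Delta=\mathcal W^c$), an action space $\mathcal U$, for each $u\in\mathcal U$ a collection $[\![\Theta^u]\!]$ of stochastic kernels on $\mathcal X$, a finite set $\mathrm{AP}$, and a Borel labelling $L:\mathcal X\to 2^{\mathrm{AP}}$. A deterministic admissible policy $\kappa$ is a sequence of measurable maps $\kappa_t$ giving the action $\mathfrak u_t=\kappa_t(X_{[0,t]},\mathfrak u_{[0,t-1]})$. A process generated by the system under $\kappa$ from an initial distribution $\nu$ is a process $(X_t,\mathfrak u_t)_{t\in\mathbb N}$ such that $X_0\sim\nu$, almost surely $\mathfrak u_t=\kappa_t(X_{[0,t]},\mathfrak u_{[0,t-1]})$ for all $t$, and for every $t$ the conditional law of $X_{t+1}$ given $(X_{[0,t]},\mathfrak u_{[0,t]})$ is $\Theta(X_t,\cdot)$ for some $\Theta\in[\![\Theta^{\mathfrak u_t}]\!]$; the choice of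 $\Theta$ may depend on $t$ and on the realized history, provided that the conditional law depends measurably on the history. The set of generated processes carries the policy as a superscript. A process satisfies $\Psi\subseteq(2^{\mathrm{AP}})^\omega$, written $X\vDash\Psi$, when $L(X_0)L(X_1)\cdots\in\Psi$; $\Psi$ is $\omega$-regular if it is the language of a finite nondeterministic Büchi automaton. *Concrete system.* Let $f:\mathbb R^n\times\mathbb R^p\to\mathbb R^n$ and $b:\mathbb R^n\to\mathbb R^{n\times k}$ be locally Lipschitz, $\vartheta\ge 0$, $\mathcal U\subset\mathbb R^p$ compact, $\mathcal W\subset\mathbb R^n$ bounded and Borel, and $L:\mathbb R^n\to 2^{\mathrm{AP}}$ Borel. Let $\mathbb{XU}$ be the controlled Markov system on $\mathbb R^n$ of $$X_{t+1}=f(X_t,\mathfrak u_t)+b(X_t)\mathbf w_t+\vartheta\,\xi_t$$ stopped on leaving $\mathcal W$: $[\![\mathcal T^u]\!]$ consists of the kernels $\mathcal T^u$ for which there is a probability law $\rho$ on $\mathbb R^n$ with $\int|\xi|_\infty\,d\rho\le 1$ such that, for $x\in\mathcal W$, $\mathcal T^u(x,\cdot)$ is the law of $f(x,u)+b(x)w+\vartheta\xi$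 with independent $w\sim\mathcal N(0,I_k)$ and $\xi\sim\rho$, and $\mathcal T^u(x,\cdot)=\delta_x$ for $x\notin\mathcal W$. *BMDP.* Let $\mathcal Q$ be a finite set with a distinguished out-of-domain state $\Delta$, $Act$ a finite set, $\check\Theta^a,\hat\Theta^a$ ($a\in Act$) real $\mathcal Q\times\mathcal Q$ matrices, and $L_{\mathbb{IA}}:\mathcal Q\to2^{\mathrm{AP}}$. Let $\mathbb{IA}$ be the controlled Markov system on $\mathcal Q$ with $[\![\Theta^a]\!]=\{\Theta\text{ stochastic}:\check\Theta^a\le\Theta\le\hat\Theta^a\text{ entrywise}\}$. *Abstraction.* Let $\alpha\subseteq\mathbb R^n\times\mathcal Q$ come from a partition: every $x$ is related to exactly one $q$, the cells $\alpha^{-1}(q)$ are Borel, and $\alpha^{-1}(\Delta)=\mathcal W^c$. Let $\Sigma_\alpha\subseteq\mathfrak P(\mathbb R^n)\times\mathfrak P(\mathcal Q)$. Say that $u\in\mathcal U$ matches $a\in Act$ at $q_i$ if for every $\mathcal T^u\in[\![\mathcal T^u]\!]$ and every $x\in\alpha^{-1}(q_i)$ there is $\Theta^a\in[\![\Theta^a]\!]$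 with $(\mathcal T^u(x,\cdot),\Theta^a_i)\in\Sigma_\alpha$ and $\mathcal T^u(x,\alpha^{-1}(q_j))=\Theta^a_{ij}$ for all $j$. Suppose $\mathbb{XU}\preceq_{\Sigma_\alpha}\mathbb{IA}$, that is, every $x$ is related to some $q$ with $L_{\mathbb{IA}}(q)=L(x)$, and for all $q_i\in\mathcal Q$ and $a\in Act$ some $u\in\mathcal U$ matches $a$ at $q_i$. A policy $\phi$ of $\mathbb{XU}$ is a $\Sigma_\alpha$-implementation of a policy $\kappa$ of $\mathbb{IA}$ if, at every time $t$ and for all paths $x_{[0,t]}$ and $q_{[0,t]}$ with $x_s\in\alpha^{-1}(q_s)$ for $s\le t$, the control $u_t$ that $\phi$ realizes along $x_{[0,t]}$ matches, at $q_t$, the action $a_t$ that $\kappa$ realizes along $q_{[0,t]}$. **Theorem.** Let $\nu_0$ be a probability measure on $\mathbb R^n$ with $\nu_0(\alpha^{-1}(q_0))=1$, and let $\kappa$ be a deterministic admissible policy of $\mathbb{IA}$. Then there is a deterministic admissible policy $\phi$ of $\mathbb{XU}$ that is a $\Sigma_\alpha$-implementation of $\kappa$ and such that, for every process $X^\phi\in\mathbb{XU}^\phi$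 with initial distribution $\nu_0$ and every $\omega$-regular $\Psi\subseteq(2^{\mathrm{AP}})^\omega$, the set $\Psi$ is Borel and $$\mathbf P_X^{\nu_0,\phi}(X^\phi\vDash\Psi)\in\bigl\{\mathcal P_I^{q_0,\kappa}(I^\kappa\vDash\Psi)\bigr\}_{I^\kappa\in\mathbb{IA}^\kappa},$$ where $I^\kappa$ ranges over the processes generated by $\mathbb{IA}$ under $\kappa$ from the initial state $q_0$. -/

import Mathlib

open MeasureTheory ProbabilityTheory

/-! ### Controlled Markov systems -/

/-- Markov (that is, stochastic) kernels from `X` to `Y`. On a finite discrete space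
`MarkovKernel Q Q` is the set of stochastic matrices, see `MarkovKernel.toMatrix`. -/
abbrev MarkovKernel (X Y : Type*) [MeasurableSpace X] [MeasurableSpace Y] :=
  {T : Kernel X Y // IsMarkovKernel T}

/-- The probability measure `T(x, ·)`. -/
def MarkovKernel.row {X Y : Type*} [MeasurableSpace X] [MeasurableSpace Y]
    (T : MarkovKernel X Y) (x : X) : ProbabilityMeasure Y :=
  ⟨T.1 x, T.2.isProbabilityMeasure x⟩

/-- The matrix of transition probabilities of a Markov kernel on a discrete space. -/
noncomputable def MarkovKernel.toMatrix {Q : Type*} [MeasurableSpace Q]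
    (T : MarkovKernel Q Q) : Matrix Q Q ℝ :=
  fun i j => (T.1 i).real {j}

/-- A controlled Markov system with states `X`, actions `U` and atomic propositions `AP`: a working
space `W` (the out-of-domain states are those of `Wᶜ`), for each action a collection of transition
kernels, and a measurable labelling function. -/
structure ControlledMarkovSystem (X U AP : Type*) [MeasurableSpace X] where
  W : Set X
  trans : U → Set (MarkovKernel X X)
  label : X → Set AP
  measurable_label : Measurable label

/-- A deterministic admissible control policy: at each time `t` the action is a measurable function
of `X_0, …, X_t` and of the previous actions `u_0, …, u_{t-1}`. -/
structure Policy (X U : Type*) [MeasurableSpace X] [MeasurableSpace U] where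
  act : (t : ℕ) → (Fin (t + 1) → X) → (Fin t → U) → U
  measurable_act : ∀ t, Measurable fun h : (Fin (t + 1) → X) × (Fin t → U) => act t h.1 h.2

/-- The control that a policy prescribes at time `t` along a path of states and controls. -/
def Policy.at {X U : Type*} [MeasurableSpace X] [MeasurableSpace U] (φ : Policy X U)
    (t : ℕ) (x : ℕ → X) (u : ℕ → U) : U :=
  φ.act t (fun s => x s) (fun s => u s)

/-- `IsProcessLaw S φ ν P`: `P` is the law, on the canonical path space `(X × U)^ℕ`, of a process
`(X, u)` generated by the system `S` under the policy `φ` from the initial distribution `ν`.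
That is, `X_0` has law `ν`; the controls are those prescribed by `φ`; and for each `t` the
conditional distribution of `X_{t+1}` given the history `(X_s, u_s)_{s ≤ t}` is `T(X_t, ·)`, where
`T` is chosen from the collection of the action `u_t` (the choice may depend on the time and on
the realized history). -/
def IsProcessLaw {X U AP : Type*} [MeasurableSpace X] [MeasurableSpace U]
    (S : ControlledMarkovSystem X U AP) (φ : Policy X U) (ν : Measure X)
    (P : Measure (ℕ → X × U)) : Prop :=
  IsProbabilityMeasure P ∧
  P.map (fun ω => (ω 0).1) = ν ∧
  (∀ t, ∀ᵐ ω ∂P, (ω t).2 = φ.at t (fun s => (ω s).1) (fun s => (ω s).2)) ∧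
  ∀ t : ℕ, ∃ K : MarkovKernel (Fin (t + 1) → X × U) X,
    (∀ h, ∃ T ∈ S.trans (h (Fin.last t)).2, K.1 h = T.1 (h (Fin.last t)).1) ∧
    P.map (fun ω => ((fun s : Fin (t + 1) => ω s), (ω (t + 1)).1)) =
      (P.map (fun ω => (fun s : Fin (t + 1) => ω s))) ⊗ₘ K.1

/-! ### Linear-time properties -/

/-- `Ψ` is an ω-regular set of infinite words: it is the language of a nondeterministic Büchi
automaton with finitely many states. -/
def IsOmegaRegular {A : Type*} (Ψ : Set (ℕ → A)) : Prop :=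
  ∃ (S : Type) (_ : Finite S) (init acc : Set S) (step : S → A → Set S),
    Ψ = {w | ∃ r : ℕ → S, r 0 ∈ init ∧ (∀ t, r (t + 1) ∈ step (r t) (w t)) ∧
      ∀ m, ∃ t ≥ m, r t ∈ acc}

/-- The event that the trace of the path of states satisfies `Ψ`. -/
def satEvent {X U AP : Type*} [MeasurableSpace X] (S : ControlledMarkovSystem X U AP)
    (Ψ : Set (ℕ → Set AP)) : Set (ℕ → X × U) :=
  {ω | (fun t => S.label (ω t).1) ∈ Ψ}

/-! ### Abstractions -/

/-- The clause shared by the definitions of abstraction and of implementation: action `u` of `XU`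
matches action `a` of `IA` at the abstract state `i`. -/
def ActionMatches {X U Q Act AP : Type*} [MeasurableSpace X] [MeasurableSpace Q]
    (XU : ControlledMarkovSystem X U AP) (IA : ControlledMarkovSystem Q Act AP)
    (α : Set (X × Q)) (Sα : Set (ProbabilityMeasure X × ProbabilityMeasure Q))
    (u : U) (a : Act) (i : Q) : Prop :=
  ∀ T ∈ XU.trans u, ∀ x, (x, i) ∈ α → ∃ Θ ∈ IA.trans a,
    (T.row x, Θ.row i) ∈ Sα ∧ ∀ j, T.1 x {y | (y, j) ∈ α} = Θ.1 i {j}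

/-- `IA` abstracts `XU` through the state-level relation `α` and the measure-level relation `Sα`. -/
def Abstracts {X U Q Act AP : Type*} [MeasurableSpace X] [MeasurableSpace Q]
    (XU : ControlledMarkovSystem X U AP) (IA : ControlledMarkovSystem Q Act AP)
    (α : Set (X × Q)) (Sα : Set (ProbabilityMeasure X × ProbabilityMeasure Q)) : Prop :=
  (∀ x, ∃ q, (x, q) ∈ α ∧ IA.label q = XU.label x) ∧
  ∀ (i : Q) (a : Act), ∃ u : U, ActionMatches XU IA α Sα u a i

/-- `α` comes from a partition of the state space into measurable cells `α⁻¹(q)`, compatible with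
the decomposition into working space and out-of-domain states. -/
def IsPartition {X U Q Act AP : Type*} [MeasurableSpace X] [MeasurableSpace Q]
    (XU : ControlledMarkovSystem X U AP) (IA : ControlledMarkovSystem Q Act AP)
    (α : Set (X × Q)) : Prop :=
  (∀ x, ∃! q, (x, q) ∈ α) ∧
  (∀ q, MeasurableSet {x | (x, q) ∈ α}) ∧
  ∀ x q, (x, q) ∈ α → (x ∈ XU.W ↔ q ∈ IA.W)

/-- `φ` is a `Sα`-implementation of `κ`: whenever `u_t` is the control realized by `φ` along a path
of `XU` and `a_t` the action realized by `κ` along an `α`-related path of `IA`, the control `u_t`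
matches `a_t` at the current abstract state. -/
def IsImplementation {X U Q Act AP : Type*} [MeasurableSpace X] [MeasurableSpace U]
    [MeasurableSpace Q] [MeasurableSpace Act]
    (XU : ControlledMarkovSystem X U AP) (IA : ControlledMarkovSystem Q Act AP)
    (α : Set (X × Q)) (Sα : Set (ProbabilityMeasure X × ProbabilityMeasure Q))
    (φ : Policy X U) (κ : Policy Q Act) : Prop :=
  ∀ (t : ℕ) (x : ℕ → X) (u : ℕ → U) (q : ℕ → Q) (a : ℕ → Act),
    (∀ s ≤ t, (x s, q s) ∈ α) → (∀ s ≤ t, u s = φ.at s x u) → (∀ s ≤ t, a s = κ.at s q a) →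
    ActionMatches XU IA α Sα (u t) (a t) (q t)

/-! ### Bounded-parameter Markov decision processes -/

/-- A BMDP with states `Q`, one of which is the out-of-domain state `out`. -/
structure BMDP (Q Act AP : Type*) where
  out : Q
  lower : Act → Matrix Q Q ℝ
  upper : Act → Matrix Q Q ℝ
  label : Q → Set AP

/-- The controlled Markov system generated by a BMDP: the collection of `a` consists of all
stochastic matrices that lie entrywise between the two bounds of `a`. -/
def BMDP.toSystem {Q Act AP : Type*} [MeasurableSpace Q] [DiscreteMeasurableSpace Q]
    (B : BMDP Q Act AP) : ControlledMarkovSystem Q Act AP where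
  W := {q | q ≠ B.out}
  trans a := {Θ | ∀ i j, B.lower a i j ≤ Θ.toMatrix i j ∧ Θ.toMatrix i j ≤ B.upper a i j}
  label := B.label
  measurable_label := .of_discrete

/-! ### The stochastic difference equation -/

/-- The data of `X_{t+1} = f(X_t, u_t) + b(X_t) w_t + ϑ ξ_t` on `ℝⁿ` (with the maximum norm of
`Fin n → ℝ`), with controls in the compact set `U`, observed in the bounded working space `W`. -/
structure StochasticDifferenceEquation (n p k : ℕ) (AP : Type*) where
  f : (Fin n → ℝ) → (Fin p → ℝ) → (Fin n → ℝ)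
  b : (Fin n → ℝ) → Matrix (Fin n) (Fin k) ℝ
  ϑ : ℝ
  U : Set (Fin p → ℝ)
  W : Set (Fin n → ℝ)
  label : (Fin n → ℝ) → Set AP
  locallyLipschitz_f : LocallyLipschitz fun z : (Fin n → ℝ) × (Fin p → ℝ) => f z.1 z.2
  locallyLipschitz_b : LocallyLipschitz fun x => (fun i j => b x i j : Fin n → Fin k → ℝ)
  nonneg_ϑ : 0 ≤ ϑ
  isCompact_U : IsCompact U
  isBounded_W : Bornology.IsBounded W
  measurableSet_W : MeasurableSet W
  measurable_label : Measurable label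

/-- The law of `f(x, u) + b(x) w + ϑ ξ`, where `w` is a standard Gaussian vector and `ξ` is
independent of `w` with law `ρ`. -/
noncomputable def StochasticDifferenceEquation.stepLaw {n p k : ℕ} {AP : Type*}
    (E : StochasticDifferenceEquation n p k AP) (ρ : Measure (Fin n → ℝ))
    (u : Fin p → ℝ) (x : Fin n → ℝ) : Measure (Fin n → ℝ) :=
  ((Measure.pi fun _ : Fin k => gaussianReal 0 1).prod ρ).map
    fun z => E.f x u + (E.b x).mulVec z.1 + E.ϑ • z.2

/-- The controlled Markov system of the equation, stopped on leaving `W`. The collection of `u`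
consists of the kernels obtained from all laws `ρ` of the perturbation with `𝔼|ξ| ≤ 1`. -/
def StochasticDifferenceEquation.toSystem {n p k : ℕ} {AP : Type*}
    (E : StochasticDifferenceEquation n p k AP) :
    ControlledMarkovSystem (Fin n → ℝ) E.U AP where
  W := E.W
  trans u := {T | ∃ ρ : Measure (Fin n → ℝ), IsProbabilityMeasure ρ ∧ ∫⁻ ξ, ‖ξ‖ₑ ∂ρ ≤ 1 ∧
    (∀ x ∈ E.W, T.1 x = E.stepLaw ρ u x) ∧ ∀ x ∉ E.W, T.1 x = Measure.dirac x}
  label := E.label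
  measurable_label := E.measurable_label

/-! The policy `φ` fixes one matching control for every abstract state and action, and applies the
one for the current cell and the action that `κ` realizes along the abstracted path. The process of
the BMDP is the image of the concrete one under `abstractPath`; labels agree along it, so the
satisfaction events correspond exactly. What must be shown is that this image is generated by the
BMDP (`IsProcessLaw.map_abstractPath`). An abstract history forgets the position inside the cells,
so the conditional law of the next cell is an average of rows of admissible matrices, possibly a
different matrix for each concrete history. Interval bounds survive averaging
(`measure_inter_bounds_of_map_eq_compProd`), and rows can be prescribed one at a time
(`BMDP.exists_mem_trans_row_eq`).

For measurability, the quantifier over runs is uncountable and has to be removed. There are finitely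
many segment profiles, every word can be cut into segments with profiles `s, e, e, …`, and
acceptance depends on `s` and `e` alone. The existence of such a cutting is again an uncountable
quantifier; merging of positions replaces it by countable ones (`mergingWords`). -/

/-! ### ω-regular languages are Borel -/

section OmegaRegular

variable {A S : Type*}

/-- The profile of the segment `w n, …, w (m - 1)` of a word: the triples `(p, q, b)` such that an
automaton can go from `p` to `q` reading the segment, and if `b = true` then it can do so while
visiting an accepting state. -/
def segmentProfile (step : S → A → Set S) (acc : Set S) (w : ℕ → A) (n m : ℕ) :
    Set (S × S × Bool) :=
  {x | ∃ r : ℕ → S, r n = x.1 ∧ r m = x.2.1 ∧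
    (∀ t, n ≤ t → t < m → r (t + 1) ∈ step (r t) (w t)) ∧
    (x.2.2 = true → ∃ t, n ≤ t ∧ t < m ∧ r t ∈ acc)}

/-- Acceptance of a word cut into segments with the profiles `σ 0, σ 1, …`. -/
def AcceptsProfiles (start : Set S) (σ : ℕ → Set (S × S × Bool)) : Prop :=
  ∃ (p : ℕ → S) (b : ℕ → Bool), p 0 ∈ start ∧ (∀ i, (p i, p (i + 1), b i) ∈ σ i) ∧
    ∀ m, ∃ i ≥ m, b i = true

/-- Runs are split and glued at time `m`. The flag `false` asserts nothing, so an implication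
between flags is enough. -/
theorem mem_segmentProfile_trans (step : S → A → Set S) (acc : Set S) (w : ℕ → A) {n m k : ℕ}
    (hnm : n ≤ m) (hmk : m ≤ k) (p q : S) (b : Bool) :
    (p, q, b) ∈ segmentProfile step acc w n k ↔
      ∃ o b₁ b₂, (p, o, b₁) ∈ segmentProfile step acc w n m ∧
        (o, q, b₂) ∈ segmentProfile step acc w m k ∧ (b = true → b₁ = true ∨ b₂ = true) := by
  classical
  constructor
  · rintro ⟨r, h1, h2, h3, h4⟩
    refine ⟨r m, decide (∃ t, n ≤ t ∧ t < m ∧ r t ∈ acc), decide (∃ t, m ≤ t ∧ t < k ∧ r t ∈ acc),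
      ⟨r, h1, rfl, fun t ht ht' => h3 t ht (by omega), by simp⟩,
      ⟨r, rfl, h2, fun t ht ht' => h3 t (by omega) ht', by simp⟩, fun hb => ?_⟩
    obtain ⟨t, ht, ht', hacc⟩ := h4 hb
    rcases lt_or_ge t m with h | h
    · exact .inl (decide_eq_true ⟨t, ht, h, hacc⟩)
    · exact .inr (decide_eq_true ⟨t, h, ht', hacc⟩)
  · rintro ⟨o, b₁, b₂, ⟨r, h1, h2, h3, h4⟩, ⟨r', h1', h2', h3', h4'⟩, hb⟩
    dsimp only at h1 h2 h4 h1' h2' h4'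
    have hl : ∀ t, t ≤ m → (if t < m then r t else r' t) = r t := by
      intro t ht
      split_ifs with h
      · rfl
      · rw [le_antisymm ht (not_lt.1 h), h1', h2]
    have hr : ∀ t, m ≤ t → (if t < m then r t else r' t) = r' t := by
      intro t ht
      rw [if_neg (not_lt.2 ht)]
    refine ⟨fun t => if t < m then r t else r' t, ?_, ?_, fun t ht ht' => ?_, fun h => ?_⟩
    · exact (hl n hnm).trans h1
    · exact (hr k hmk).trans h2'
    · dsimp only
      rcases lt_or_ge t m with h | h
      · rw [hl t h.le, hl (t + 1) h]
        exact h3 t ht h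
      · rw [hr t h, hr (t + 1) (by omega)]
        exact h3' t h ht'
    · rcases hb h with h | h
      · obtain ⟨t, ht, ht', hacc⟩ := h4 h
        exact ⟨t, ht, by omega, by dsimp only; rwa [hl t ht'.le]⟩
      · obtain ⟨t, ht, ht', hacc⟩ := h4' h
        exact ⟨t, by omega, ht', by dsimp only; rwa [hr t ht]⟩

/-- Positions that have merged stay merged. -/
theorem segmentProfile_congr (step : S → A → Set S) (acc : Set S) (w : ℕ → A) {n m k l : ℕ}
    (hn : n ≤ k) (hm : m ≤ k) (hkl : k ≤ l)
    (h : segmentProfile step acc w n k = segmentProfile step acc w m k) :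
    segmentProfile step acc w n l = segmentProfile step acc w m l := by
  ext ⟨p, q, b⟩
  rw [mem_segmentProfile_trans step acc w hn hkl, mem_segmentProfile_trans step acc w hm hkl, h]

theorem segmentProfile_congr_word (step : S → A → Set S) (acc : Set S) {w w' : ℕ → A} {n m : ℕ}
    (h : ∀ t < m, w t = w' t) :
    segmentProfile step acc w n m = segmentProfile step acc w' n m := by
  ext x
  refine exists_congr fun r => and_congr_right fun _ => and_congr_right fun _ =>
    and_congr_left fun _ => forall_congr' fun t => forall_congr' fun _ => forall_congr' fun ht => ?_
  rw [h t ht]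

theorem StrictMono.exists_le_lt_succ {c : ℕ → ℕ} (hc : StrictMono c) (h0 : c 0 = 0) (t : ℕ) :
    ∃ i, c i ≤ t ∧ t < c (i + 1) := by
  induction t with
  | zero => exact ⟨0, h0.le, h0.symm.trans_lt (hc (Nat.lt_succ_self 0))⟩
  | succ t ih =>
    obtain ⟨i, hi, hi'⟩ := ih
    by_cases h : t + 1 < c (i + 1)
    · exact ⟨i, by omega, h⟩
    · have : c (i + 1) < c (i + 1 + 1) := hc (Nat.lt_succ_self _)
      exact ⟨i + 1, by omega, by omega⟩

theorem StrictMono.eq_of_le_lt_succ {c : ℕ → ℕ} (hc : StrictMono c) {t i j : ℕ}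
    (hi : c i ≤ t) (hi' : t < c (i + 1)) (hj : c j ≤ t) (hj' : t < c (j + 1)) : i = j := by
  have h1 : i < j + 1 := hc.lt_iff_lt.1 (hi.trans_lt hj')
  have h2 : j < i + 1 := hc.lt_iff_lt.1 (hj.trans_lt hi')
  omega

/-- Büchi acceptance of a word can be read off the profiles of the segments of any subdivision. -/
theorem buchi_accepts_iff_acceptsProfiles (start acc : Set S) (step : S → A → Set S) (w : ℕ → A)
    {c : ℕ → ℕ} (hc : StrictMono c) (h0 : c 0 = 0) :
    (∃ r : ℕ → S, r 0 ∈ start ∧ (∀ t, r (t + 1) ∈ step (r t) (w t)) ∧ ∀ m, ∃ t ≥ m, r t ∈ acc) ↔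
      AcceptsProfiles start fun i => segmentProfile step acc w (c i) (c (i + 1)) := by
  classical
  choose idx hidx hidx' using hc.exists_le_lt_succ h0
  have hidx_eq : ∀ {t i}, c i ≤ t → t < c (i + 1) → idx t = i := fun h h' =>
    hc.eq_of_le_lt_succ (hidx _) (hidx' _) h h'
  constructor
  · rintro ⟨r, hr0, hr, hacc⟩
    refine ⟨fun i => r (c i), fun i => decide (∃ t, c i ≤ t ∧ t < c (i + 1) ∧ r t ∈ acc),
      by dsimp only; rwa [h0], fun i => ⟨r, rfl, rfl, fun t _ _ => hr t, by simp⟩, fun m => ?_⟩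
    obtain ⟨t, ht, hta⟩ := hacc (c m)
    refine ⟨idx t, ?_, decide_eq_true ⟨t, hidx t, hidx' t, hta⟩⟩
    have : m < idx t + 1 := hc.lt_iff_lt.1 (ht.trans_lt (hidx' t))
    exact Nat.lt_succ_iff.1 this
  · rintro ⟨p, b, hp0, hp, hb⟩
    choose r h1 h2 h3 h4 using hp
    dsimp only at h1 h2 h4
    have hlt : ∀ i, c i < c (i + 1) := fun i => hc (Nat.lt_succ_self i)
    -- At time `t`, follow the run of the block that contains `t`; consecutive runs agree at the
    -- common cut.
    refine ⟨fun t => r (idx t) t, ?_, fun t => ?_, fun m => ?_⟩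
    · have : idx 0 = 0 := hidx_eq h0.le (h0.symm.trans_lt (hlt 0))
      have h := h1 0
      rw [h0] at h
      dsimp only
      rwa [this, h]
    · have key : r (idx (t + 1)) (t + 1) = r (idx t) (t + 1) := by
        by_cases h : t + 1 < c (idx t + 1)
        · rw [hidx_eq ((hidx t).trans (Nat.le_succ t)) h]
        · have he : t + 1 = c (idx t + 1) := by have := hidx' t; omega
          have : idx (t + 1) = idx t + 1 := hidx_eq he.ge (he ▸ hlt _)
          rw [this, he, h1, h2]
      dsimp only
      rw [key]
      exact h3 (idx t) t (hidx t) (hidx' t)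
    · obtain ⟨i, hi, hbi⟩ := hb m
      obtain ⟨t, ht, ht', hacc⟩ := h4 i hbi
      refine ⟨t, hi.le.trans ((hc.id_le i).trans ht), ?_⟩
      dsimp only
      rwa [hidx_eq ht ht']

/-- The words with a cut `n` such that the initial segment has profile `s` and there are infinitely
many positions `m` that merge with `n` and for which the segment from `n` to `m` has profile `e`. -/
def mergingWords (step : S → A → Set S) (acc : Set S) (s e : Set (S × S × Bool)) :
    Set (ℕ → A) :=
  {w | ∃ n > 0, segmentProfile step acc w 0 n = s ∧ ∀ N, ∃ m > N, n < m ∧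
    segmentProfile step acc w n m = e ∧
      ∃ k ≥ m, segmentProfile step acc w n k = segmentProfile step acc w m k}

/-- Only the first `m` letters matter, so the condition factors through the countable discrete space
`Fin m → A`; the letter `a₀` is padding. -/
theorem measurableSet_segmentProfile [Countable A] [MeasurableSpace A] [DiscreteMeasurableSpace A]
    (step : S → A → Set S) (acc : Set S) (n m : ℕ) (C : Set (S × S × Bool) → Prop) :
    MeasurableSet {w | C (segmentProfile step acc w n m)} := by
  rcases isEmpty_or_nonempty A with hA | ⟨⟨a₀⟩⟩
  · have : IsEmpty (ℕ → A) := ⟨fun w => hA.elim (w 0)⟩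
    exact (Set.subsingleton_of_subsingleton (α := ℕ → A)).measurableSet
  have hr : Measurable fun (w : ℕ → A) (i : Fin m) => w i :=
    measurable_pi_lambda _ fun i => measurable_pi_apply _
  convert hr (MeasurableSet.of_discrete (s := {v : Fin m → A | C (segmentProfile step acc
    (fun t => if h : t < m then v ⟨t, h⟩ else a₀) n m)})) using 1
  ext w
  simp only [Set.mem_ofPred_eq, Set.mem_preimage]
  rw [segmentProfile_congr_word step acc (w' := fun t => if h : t < m then w t else a₀)]
  intro t ht
  rw [dif_pos ht]

theorem measurableSet_mergingWords [Countable A] [MeasurableSpace A] [DiscreteMeasurableSpace A]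
    [Finite S] (step : S → A → Set S) (acc : Set S) (s e : Set (S × S × Bool)) :
    MeasurableSet (mergingWords step acc s e) := by
  have hm : ∀ n m, MeasurableSet {w : ℕ → A | ∃ k ≥ m, segmentProfile step acc w n k =
      segmentProfile step acc w m k} := by
    intro n m
    have : {w : ℕ → A | ∃ k ≥ m, segmentProfile step acc w n k = segmentProfile step acc w m k} =
        ⋃ k, ⋃ (_ : k ≥ m), ⋃ d, {w | segmentProfile step acc w n k = d} ∩
          {w | segmentProfile step acc w m k = d} := by
      ext w
      simp [eq_comm]
    rw [this]
    exact .iUnion fun k => .iUnion fun _ => .iUnion fun d =>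
      (measurableSet_segmentProfile step acc n k (· = d)).inter
        (measurableSet_segmentProfile step acc m k (· = d))
  have : mergingWords step acc s e = ⋃ n, ⋃ (_ : n > 0), {w | segmentProfile step acc w 0 n = s} ∩
      ⋂ N, ⋃ m, ⋃ (_ : m > N), ⋃ (_ : n < m), {w | segmentProfile step acc w n m = e} ∩
        {w | ∃ k ≥ m, segmentProfile step acc w n k = segmentProfile step acc w m k} := by
    ext w
    simp [mergingWords, and_left_comm, and_comm]
  rw [this]
  exact .iUnion fun n => .iUnion fun _ =>
    (measurableSet_segmentProfile step acc 0 n (· = s)).inter <| .iInter fun N => .iUnion fun m =>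
      .iUnion fun _ => .iUnion fun _ =>
        (measurableSet_segmentProfile step acc n m (· = e)).inter (hm n m)

/-- A merging word can be cut into segments with the profiles `s, e, e, e, …`. -/
theorem exists_subdivision_of_mem_mergingWords {step : S → A → Set S} {acc : Set S}
    {s e : Set (S × S × Bool)} {w : ℕ → A} (hw : w ∈ mergingWords step acc s e) :
    ∃ c : ℕ → ℕ, StrictMono c ∧ c 0 = 0 ∧
      (fun i => segmentProfile step acc w (c i) (c (i + 1))) =
        fun i => if i = 0 then s else e := by
  obtain ⟨n, hn, hs, h⟩ := hw
  let M := {m : ℕ // n ≤ m ∧ ∃ k ≥ m, segmentProfile step acc w n k = segmentProfile step acc w m k}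
  -- If `m` has merged with `n` by time `k`, take the next cut `m'` beyond `k`: the segments from
  -- `n` and from `m` to `m'` then both have profile `e`.
  have hnext : ∀ m : M, ∃ m' : M, m.1 < m'.1 ∧ segmentProfile step acc w m.1 m'.1 = e := by
    rintro ⟨m, hm, k, hk, hmk⟩
    obtain ⟨m', hm', hnm', he, hmerge⟩ := h k
    exact ⟨⟨m', hnm'.le, hmerge⟩, hk.trans_lt hm',
      (segmentProfile_congr step acc w (hm.trans hk) hk hm'.le hmk).symm.trans he⟩
  choose f hf hf' using hnext
  let d : ℕ → M := fun i => Nat.rec ⟨n, le_rfl, n, le_rfl, rfl⟩ (fun _ => f) i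
  refine ⟨fun i => Nat.casesOn i 0 fun j => (d j).1, strictMono_nat_of_lt_succ ?_, rfl, ?_⟩
  · rintro (_ | i)
    · exact hn
    · exact hf (d i)
  · funext i
    rcases i with _ | i
    · exact hs
    · exact hf' (d i)

/-- Every word is merging, for suitable profiles. -/
theorem exists_mem_mergingWords [Finite S] (step : S → A → Set S) (acc : Set S) (w : ℕ → A) :
    ∃ s e, w ∈ mergingWords step acc s e := by
  -- Finitely many profiles: along a nonprincipal ultrafilter, the profile from `n` to `k` is
  -- eventually constant in `k`. Positions with the same limit merge.
  have hlim : ∀ n, ∃ d, ∀ᶠ k in (Filter.hyperfilter ℕ : Filter ℕ),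
      segmentProfile step acc w n k = d := by
    intro n
    obtain ⟨d, hd⟩ := ((Filter.hyperfilter ℕ).map (segmentProfile step acc w n)).eq_pure_of_finite
    refine ⟨d, ?_⟩
    have : ({d} : Set _) ∈ (Filter.hyperfilter ℕ).map (segmentProfile step acc w n) := by
      rw [hd]; exact Filter.mem_pure.2 rfl
    exact this
  choose D hD using hlim
  obtain ⟨d, hd⟩ := Finite.exists_infinite_fiber D
  have hinf : (D ⁻¹' {d}).Infinite := Set.infinite_coe_iff.1 hd
  obtain ⟨n, hnd, hn⟩ := hinf.exists_gt 0
  have := hinf.to_subtype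
  -- A second pigeonhole, among the positions with limit `d`, fixes the profile of the segment from
  -- `n`.
  obtain ⟨e, he⟩ := Finite.exists_infinite_fiber
    fun m : D ⁻¹' {d} => segmentProfile step acc w n m
  have hinf' : (((↑) : D ⁻¹' {d} → ℕ) '' ((fun m : D ⁻¹' {d} =>
      segmentProfile step acc w n m) ⁻¹' {e})).Infinite :=
    (Set.infinite_coe_iff.1 he).image Subtype.val_injective.injOn
  refine ⟨_, e, n, hn, rfl, fun N => ?_⟩
  obtain ⟨_, ⟨m, hm, rfl⟩, hmN⟩ := hinf'.exists_gt (max N n)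
  have hlarge : ∀ᶠ k in (Filter.hyperfilter ℕ : Filter ℕ), (m : ℕ) ≤ k :=
    Nat.hyperfilter_le_atTop (Filter.eventually_ge_atTop _)
  obtain ⟨k, hk, hk1, hk2⟩ := (hlarge.and ((hD n).and (hD m))).exists
  refine ⟨m, (le_max_left _ _).trans_lt hmN, (le_max_right _ _).trans_lt hmN, hm, k, hk, ?_⟩
  rw [hk1, hk2, show D n = d from hnd, show D m = d from m.2]

/-- Acceptance is constant on each set `mergingWords step acc s e`, and these finitely many sets
cover all words. -/
theorem IsOmegaRegular.measurableSet [Countable A] [MeasurableSpace A] [DiscreteMeasurableSpace A]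
    {Ψ : Set (ℕ → A)} (hΨ : IsOmegaRegular Ψ) : MeasurableSet Ψ := by
  obtain ⟨S, _, start, acc, step, rfl⟩ := hΨ
  have : {w : ℕ → A | ∃ r : ℕ → S, r 0 ∈ start ∧ (∀ t, r (t + 1) ∈ step (r t) (w t)) ∧
      ∀ m, ∃ t ≥ m, r t ∈ acc} =
      ⋃ s, ⋃ e, ⋃ (_ : AcceptsProfiles start fun i => if i = 0 then s else e),
        mergingWords step acc s e := by
    ext w
    simp only [Set.mem_ofPred_eq, Set.mem_iUnion, exists_prop]
    constructor
    · intro h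
      obtain ⟨s, e, hw⟩ := exists_mem_mergingWords step acc w
      obtain ⟨c, hc, h0, hce⟩ := exists_subdivision_of_mem_mergingWords hw
      exact ⟨s, e, hce ▸ (buchi_accepts_iff_acceptsProfiles start acc step w hc h0).1 h, hw⟩
    · rintro ⟨s, e, hacc, hw⟩
      obtain ⟨c, hc, h0, hce⟩ := exists_subdivision_of_mem_mergingWords hw
      exact (buchi_accepts_iff_acceptsProfiles start acc step w hc h0).2 (hce ▸ hacc)
  rw [this]
  exact .iUnion fun s => .iUnion fun e => .iUnion fun _ => measurableSet_mergingWords step acc s e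

end OmegaRegular

/-! ### Policies along paths -/

section Policy

/-- The path that extends a finite path by its last state. -/
def extendPath {X : Type*} {t : ℕ} (x : Fin (t + 1) → X) (s : ℕ) : X :=
  x ⟨min s t, Nat.lt_succ_iff.2 (min_le_right s t)⟩

theorem extendPath_of_le {X : Type*} {t : ℕ} (x : ℕ → X) {s : ℕ} (hs : s ≤ t) :
    extendPath (fun r : Fin (t + 1) => x r) s = x s := by
  simp [extendPath, min_eq_left hs]

variable {X U Q Act : Type*} [MeasurableSpace X] [MeasurableSpace U] [MeasurableSpace Q]
  [MeasurableSpace Act]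

/-- The sequence of controls that a policy realizes along a path of states. -/
noncomputable def Policy.realized (κ : Policy X U) (x : ℕ → X) (t : ℕ) : U :=
  κ.act t (fun s => x s) fun s => κ.realized x s
termination_by t
decreasing_by exact s.2

theorem Policy.realized_eq_at (κ : Policy X U) (x : ℕ → X) (t : ℕ) :
    κ.realized x t = κ.at t x (κ.realized x) := by
  rw [Policy.realized, Policy.at]

theorem Policy.realized_congr (κ : Policy X U) {x x' : ℕ → X} {t : ℕ}
    (h : ∀ s ≤ t, x s = x' s) : κ.realized x t = κ.realized x' t := by
  induction t using Nat.strong_induction_on with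
  | _ t ih =>
    rw [Policy.realized, Policy.realized]
    congr 1
    · funext s
      exact h s (Nat.lt_succ_iff.1 s.2)
    · funext s
      exact ih s s.2 fun r hr => h r (hr.trans s.2.le)

theorem Policy.eq_realized (κ : Policy X U) {x : ℕ → X} {u : ℕ → U} {t : ℕ}
    (h : ∀ s ≤ t, u s = κ.at s x u) : u t = κ.realized x t := by
  induction t using Nat.strong_induction_on with
  | _ t ih =>
    rw [Policy.realized, h t le_rfl, Policy.at]
    congr 1
    funext s
    exact ih s s.2 fun r hr => h r (hr.trans s.2.le)

theorem Policy.measurable_realized (κ : Policy X U) (t : ℕ) :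
    Measurable fun x => κ.realized x t := by
  induction t using Nat.strong_induction_on with
  | _ t ih =>
    have h : (fun x => κ.realized x t) = (fun h : (Fin (t + 1) → X) × (Fin t → U) =>
        κ.act t h.1 h.2) ∘ fun x => (fun s => x s, fun s => κ.realized x s) := by
      funext x
      rw [Policy.realized]
      rfl
    rw [h]
    exact (κ.measurable_act t).comp
      ((measurable_pi_lambda _ fun s => measurable_pi_apply _).prodMk
        (measurable_pi_lambda _ fun s => ih s s.2))

theorem measurable_extendPath (t : ℕ) :
    Measurable (extendPath : (Fin (t + 1) → X) → ℕ → X) :=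
  measurable_pi_lambda _ fun _ => measurable_pi_apply _

/-- The path of abstract states and actions of `κ` along the abstraction of a path. -/
noncomputable def abstractPath (cell : X → Q) (κ : Policy Q Act) (x : ℕ → X) (t : ℕ) : Q × Act :=
  (cell (x t), κ.realized (fun s => cell (x s)) t)

theorem abstractPath_congr {Y : Type*} (cell : Y → Q) (κ : Policy Q Act) {x x' : ℕ → Y} {t : ℕ}
    (h : ∀ s ≤ t, x s = x' s) : abstractPath cell κ x t = abstractPath cell κ x' t :=
  Prod.ext (congrArg cell (h t le_rfl)) (κ.realized_congr fun s hs => congrArg cell (h s hs))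

theorem measurable_abstractPath {cell : X → Q} (hcell : Measurable cell) (κ : Policy Q Act) :
    Measurable (abstractPath cell κ) :=
  measurable_pi_lambda _ fun t => (hcell.comp (measurable_pi_apply t)).prodMk
    ((κ.measurable_realized t).comp
      (measurable_pi_lambda _ fun s => hcell.comp (measurable_pi_apply s)))

/-- The policy that, at a state of the cell `q`, applies the control `m q a`, where `a` is the action
that `κ` realizes along the abstraction of the path. -/
noncomputable def Policy.implement [DiscreteMeasurableSpace (Q × Act)] (κ : Policy Q Act)
    {cell : X → Q} (hcell : Measurable cell) (m : Q × Act → U) : Policy X U where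
  -- Past controls are not consulted: the actions of `κ` are recomputed from the states. The
  -- artificial tail of `extendPath x` has no influence up to time `t`.
  act t x _ := m (abstractPath cell κ (extendPath x) t)
  measurable_act t := (Measurable.of_discrete (f := m)).comp
    ((measurable_pi_apply t).comp ((measurable_abstractPath hcell κ).comp
      ((measurable_extendPath t).comp measurable_fst)))

theorem Policy.implement_at [DiscreteMeasurableSpace (Q × Act)] (κ : Policy Q Act)
    {cell : X → Q} (hcell : Measurable cell) (m : Q × Act → U) (t : ℕ) (x : ℕ → X) (u : ℕ → U) :
    (κ.implement hcell m).at t x u = m (abstractPath cell κ x t) :=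
  congrArg m (abstractPath_congr cell κ fun _ hs => extendPath_of_le x hs)

end Policy

/-! ### Abstraction of process laws -/

section Abstraction

/-- If the conditional probability of `Y ∈ C` given `Z` lies between `l` and `u` on the event
`Z ∈ D`, then so does the probability of `Y ∈ C` given this event. -/
theorem measure_inter_bounds_of_map_eq_compProd {Ω H Y : Type*} [MeasurableSpace Ω]
    [MeasurableSpace H] [MeasurableSpace Y] {P : Measure Ω} [IsProbabilityMeasure P]
    {Z : Ω → H} {V : Ω → Y} (hZ : Measurable Z) (hV : Measurable V)
    {K : Kernel H Y} [IsMarkovKernel K] (hK : P.map (fun ω => (Z ω, V ω)) = P.map Z ⊗ₘ K)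
    {D : Set H} (hD : MeasurableSet D) {C : Set Y} (hC : MeasurableSet C) {l u : ℝ}
    (hPD : P (Z ⁻¹' D) ≠ 0)
    (h : ∀ᵐ ω ∂P, Z ω ∈ D → l ≤ (K (Z ω)).real C ∧ (K (Z ω)).real C ≤ u) :
    l ≤ ((P (Z ⁻¹' D))⁻¹ * P (Z ⁻¹' D ∩ V ⁻¹' C)).toReal ∧
      ((P (Z ⁻¹' D))⁻¹ * P (Z ⁻¹' D ∩ V ⁻¹' C)).toReal ≤ u := by
  have hint : P (Z ⁻¹' D ∩ V ⁻¹' C) = ∫⁻ ω in Z ⁻¹' D, K (Z ω) C ∂P := by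
    rw [← setLIntegral_map hD (K.measurable_coe hC) hZ, ← Measure.compProd_apply_prod hD hC, ← hK,
      Measure.map_apply (hZ.prodMk hV) (hD.prod hC)]
    rfl
  -- A negative upper bound would make the conditioning event null; nonnegativity is needed to pass
  -- to `ENNReal`.
  have hu : 0 ≤ u := by
    by_contra hu
    refine hPD (measure_eq_zero_iff_ae_notMem.2 ?_)
    filter_upwards [h] with ω hω hωD
    exact hu (measureReal_nonneg.trans (hω hωD).2)
  have htop : P (Z ⁻¹' D) ≠ ⊤ := measure_ne_top _ _
  rw [mul_comm, ← div_eq_mul_inv]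
  constructor
  · refine (ENNReal.ofReal_le_iff_le_toReal (ENNReal.div_ne_top (measure_ne_top _ _) hPD)).1 ?_
    rw [ENNReal.le_div_iff_mul_le (.inl hPD) (.inl htop), hint, ← setLIntegral_const]
    refine setLIntegral_mono_ae' (hZ hD) ?_
    filter_upwards [h] with ω hω hωD
    exact ENNReal.ofReal_le_of_le_toReal (hω hωD).1
  · refine ENNReal.toReal_le_of_le_ofReal hu (ENNReal.div_le_of_le_mul ?_)
    rw [hint, ← setLIntegral_const]
    refine setLIntegral_mono_ae' (hZ hD) ?_
    filter_upwards [h] with ω hω hωD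
    rw [← ofReal_measureReal (measure_ne_top _ _)]
    exact ENNReal.ofReal_le_ofReal (hω hωD).2

/-- The bounds are entrywise, so row `i` of any admissible matrix may be replaced; nonemptiness
supplies the other rows. -/
theorem BMDP.exists_mem_trans_row_eq {Q Act AP : Type*} [Finite Q] [MeasurableSpace Q]
    [DiscreteMeasurableSpace Q] (B : BMDP Q Act AP) {a : Act} (ha : (B.toSystem.trans a).Nonempty)
    {i : Q} {μ : Measure Q} [IsProbabilityMeasure μ]
    (hμ : ∀ j, B.lower a i j ≤ μ.real {j} ∧ μ.real {j} ≤ B.upper a i j) :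
    ∃ Θ ∈ B.toSystem.trans a, Θ.1 i = μ := by
  classical
  obtain ⟨Θ, hΘ⟩ := ha
  have := Θ.2
  have hmarkov : IsMarkovKernel (Kernel.ofFunOfCountable (Function.update Θ.1 i μ)) := by
    refine ⟨fun j => ?_⟩
    change IsProbabilityMeasure (Function.update Θ.1 i μ j)
    rcases eq_or_ne j i with rfl | h
    · rw [Function.update_self]; infer_instance
    · rw [Function.update_of_ne h]; infer_instance
  refine ⟨⟨_, hmarkov⟩, fun i' j => ?_, by
    change Function.update Θ.1 i μ i = μ
    rw [Function.update_self]⟩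
  change _ ≤ (Function.update Θ.1 i μ i').real {j} ∧ (Function.update Θ.1 i μ i').real {j} ≤ _
  rcases eq_or_ne i' i with rfl | h
  · rw [Function.update_self]; exact hμ j
  · rw [Function.update_of_ne h]; exact hΘ i' j

theorem measurableSet_satEvent {X U AP : Type*} [MeasurableSpace X] [MeasurableSpace U]
    (S : ControlledMarkovSystem X U AP) {Ψ : Set (ℕ → Set AP)} (hΨ : MeasurableSet Ψ) :
    MeasurableSet (satEvent S Ψ) := by
  have h : Measurable fun (ω : ℕ → X × U) t => S.label (ω t).1 :=
    measurable_pi_lambda _ fun t =>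
      S.measurable_label.comp (measurable_fst.comp (measurable_pi_apply t))
  exact h hΨ

/-- Related paths have the same trace. -/
theorem preimage_satEvent_abstractPath {X U Q Act AP : Type*} [MeasurableSpace X]
    [MeasurableSpace Q] [DiscreteMeasurableSpace Q] [MeasurableSpace Act]
    {XU : ControlledMarkovSystem X U AP} {B : BMDP Q Act AP} {cell : X → Q}
    (hlabel : ∀ x, B.label (cell x) = XU.label x)
    (κ : Policy Q Act) (Ψ : Set (ℕ → Set AP)) :
    (fun ω : ℕ → X × U => abstractPath cell κ fun t => (ω t).1) ⁻¹' satEvent B.toSystem Ψ =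
      satEvent XU Ψ := by
  ext ω
  have h : (fun t => B.label (cell (ω t).1)) = fun t => XU.label (ω t).1 :=
    funext fun t => hlabel _
  exact iff_of_eq (congrArg (· ∈ Ψ) h)

variable {X U Q Act AP : Type*} [MeasurableSpace X] [MeasurableSpace U]
  [Finite Q] [MeasurableSpace Q] [DiscreteMeasurableSpace Q]
  [Finite Act] [MeasurableSpace Act] [DiscreteMeasurableSpace Act]
  {XU : ControlledMarkovSystem X U AP} {B : BMDP Q Act AP} {α : Set (X × Q)}
  {Sα : Set (ProbabilityMeasure X × ProbabilityMeasure Q)} {cell : X → Q}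

theorem isImplementation_implement {κ : Policy Q Act} (hα : ∀ x q, (x, q) ∈ α ↔ cell x = q)
    (hcell : Measurable cell) {m : Q × Act → U}
    (hm : ∀ i a, ActionMatches XU B.toSystem α Sα (m (i, a)) a i) :
    IsImplementation XU B.toSystem α Sα (κ.implement hcell m) κ := by
  intro t x u q a hxq hu ha
  have hq : ∀ s ≤ t, cell (x s) = q s := fun s hs => (hα _ _).1 (hxq s hs)
  rw [hu t le_rfl, Policy.implement_at, abstractPath, κ.realized_congr hq, hq t le_rfl,
    ← κ.eq_realized ha]
  exact hm _ _

/-- The law of the abstraction of a process generated under an implementation of `κ` is the law of a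
process generated by the BMDP under `κ`. -/
theorem IsProcessLaw.map_abstractPath {φ : Policy X U} {κ : Policy Q Act} {ν : Measure X}
    [IsProbabilityMeasure ν] {q₀ : Q} {P : Measure (ℕ → X × U)} (hP : IsProcessLaw XU φ ν P)
    (hα : ∀ x q, (x, q) ∈ α ↔ cell x = q) (hcell : Measurable cell)
    (hφ : IsImplementation XU B.toSystem α Sα φ κ) (hB : ∀ a, (B.toSystem.trans a).Nonempty)
    (hν : ν (cell ⁻¹' {q₀}) = 1) :
    IsProcessLaw B.toSystem κ (Measure.dirac q₀)
      (P.map fun ω => abstractPath cell κ fun t => (ω t).1) := by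
  classical
  obtain ⟨hprob, hinit, hctrl, hstep⟩ := hP
  have hstates : Measurable fun (ω : ℕ → X × U) t => (ω t).1 :=
    measurable_pi_lambda _ fun t => measurable_fst.comp (measurable_pi_apply t)
  have hg : Measurable fun ω : ℕ → X × U => abstractPath cell κ fun t => (ω t).1 :=
    (measurable_abstractPath hcell κ).comp hstates
  refine ⟨Measure.isProbabilityMeasure_map hg.aemeasurable, ?_, fun t => ?_, fun t => ?_⟩
  · have h1 : (P.map fun ω => abstractPath cell κ fun t => (ω t).1).map (fun ω => (ω 0).1) =
        (P.map fun ω => (ω 0).1).map cell := by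
      rw [Measure.map_map (by fun_prop) hg, Measure.map_map hcell (by fun_prop)]
      rfl
    have hae : cell =ᵐ[ν] fun _ => q₀ := (prob_compl_eq_zero_iff (hcell (.singleton q₀))).2 hν
    rw [h1, hinit, Measure.map_congr hae, Measure.map_const, measure_univ, one_smul]
  · refine (ae_map_iff hg.aemeasurable ?_).2 (ae_of_all _ fun ω => κ.realized_eq_at _ t)
    refine measurableSet_eq_fun (by fun_prop) ((κ.measurable_act t).comp
      (g := fun h : (Fin (t + 1) → Q) × (Fin t → Act) => κ.act t h.1 h.2)
      (f := fun ω : ℕ → Q × Act => (fun s => (ω s).1, fun s => (ω s).2)) (by fun_prop))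
  · obtain ⟨K, hKtrans, hK⟩ := hstep t
    have := K.2
    have : Nonempty Q := ⟨q₀⟩
    let Z : (ℕ → X × U) → Fin (t + 1) → X × U := fun ω s => ω s
    let Z' : (ℕ → X × U) → Fin (t + 1) → Q × Act :=
      fun ω s => abstractPath cell κ (fun t => (ω t).1) s
    let V : (ℕ → X × U) → Q := fun ω => cell (ω (t + 1)).1
    have hZ : Measurable Z := by fun_prop
    have hZ' : Measurable Z' := measurable_pi_lambda _ fun s => (measurable_pi_apply _).comp hg
    have hV : Measurable V := hcell.comp (by fun_prop)
    -- For null histories any admissible matrix will do, since kernels are compared only almost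
    -- everywhere.
    have hrow : ∀ h : Fin (t + 1) → Q × Act, ∃ Θ ∈ B.toSystem.trans (h (Fin.last t)).2,
        P.map Z' {h} ≠ 0 → Θ.1 (h (Fin.last t)).1 = condDistrib V Z' P h := by
      intro h
      by_cases hh : P.map Z' {h} = 0
      · obtain ⟨Θ, hΘ⟩ := hB (h (Fin.last t)).2
        exact ⟨Θ, hΘ, fun h0 => absurd hh h0⟩
      have hbounds : ∀ j, B.lower (h (Fin.last t)).2 (h (Fin.last t)).1 j ≤
          (condDistrib V Z' P h).real {j} ∧
          (condDistrib V Z' P h).real {j} ≤ B.upper (h (Fin.last t)).2 (h (Fin.last t)).1 j := by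
        intro j
        -- The concrete histories whose abstraction is `h`; the conditional law given `h` averages
        -- over them.
        let D : Set (Fin (t + 1) → X × U) := {x | (fun s : Fin (t + 1) =>
          abstractPath cell κ (fun r => (extendPath x r).1) s) = h}
        have hD : MeasurableSet D := by
          have hm : Measurable fun (x : Fin (t + 1) → X × U) (s : Fin (t + 1)) =>
              abstractPath cell κ (fun r => (extendPath x r).1) s :=
            measurable_pi_lambda _ fun s => (measurable_pi_apply (s : ℕ)).comp
              ((measurable_abstractPath hcell κ).comp (hstates.comp (measurable_extendPath t)))
          exact hm (.singleton h)
        have hZD : Z ⁻¹' D = Z' ⁻¹' {h} := by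
          ext ω
          refine Eq.congr_left (funext fun s => abstractPath_congr cell κ fun r hr => ?_)
          rw [extendPath_of_le ω (hr.trans (Nat.lt_succ_iff.1 s.2))]
        have hae : ∀ᵐ ω ∂P, Z ω ∈ D →
            B.lower (h (Fin.last t)).2 (h (Fin.last t)).1 j ≤ (K.1 (Z ω)).real (cell ⁻¹' {j}) ∧
            (K.1 (Z ω)).real (cell ⁻¹' {j}) ≤
              B.upper (h (Fin.last t)).2 (h (Fin.last t)).1 j := by
          -- The matrix found by matching depends on `ω`; its bounds depend only on the last state
          -- and action of `h`.
          filter_upwards [ae_all_iff.2 hctrl] with ω hω hωD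
          have hωh : Z' ω = h := (Set.ext_iff.1 hZD ω).1 hωD
          obtain ⟨T, hT, hKT⟩ := hKtrans (Z ω)
          obtain ⟨Θ, hΘ, -, hTΘ⟩ := hφ t (fun s => (ω s).1) (fun s => (ω s).2)
            (fun s => cell (ω s).1) (κ.realized fun s => cell (ω s).1)
            (fun s _ => (hα _ _).2 rfl) (fun s _ => hω s) (fun s _ => κ.realized_eq_at _ s)
            T hT (ω t).1 ((hα _ _).2 rfl)
          have hC : {y | (y, j) ∈ α} = cell ⁻¹' {j} := Set.ext fun y => hα y j
          have hreal : (K.1 (Z ω)).real (cell ⁻¹' {j}) = Θ.toMatrix (cell (ω t).1) j := by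
            rw [hKT, ← hC]
            exact congrArg ENNReal.toReal (hTΘ j)
          rw [hreal, ← hωh]
          exact hΘ _ j
        -- At an atom, the conditional distribution is the elementary quotient.
        have hcond : condDistrib V Z' P h {j} = (P (Z' ⁻¹' {h}))⁻¹ *
            P (Z' ⁻¹' {h} ∩ V ⁻¹' {j}) := by
          rw [condDistrib_apply_of_ne_zero hV _ hh, Measure.map_apply hZ' (.singleton h),
            Measure.map_apply (hZ'.prodMk hV) ((MeasurableSet.singleton h).prod (.singleton j))]
          rfl
        rw [Measure.map_apply hZ' (.singleton h), ← hZD] at hh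
        rw [measureReal_def, hcond, ← hZD]
        exact measure_inter_bounds_of_map_eq_compProd hZ
          (measurable_fst.comp (measurable_pi_apply (t + 1))) hK hD (hcell (.singleton j)) hh hae
      obtain ⟨Θ, hΘ, hΘh⟩ := B.exists_mem_trans_row_eq (hB _) hbounds
      exact ⟨Θ, hΘ, fun _ => hΘh⟩
    -- No measurable selection is needed: there are finitely many abstract histories of length `t +
    -- 1`.
    choose Θ hΘ hΘh using hrow
    refine ⟨⟨Kernel.ofFunOfCountable fun h => (Θ h).1 (h (Fin.last t)).1,
      ⟨fun h => (Θ h).2.isProbabilityMeasure _⟩⟩, fun h => ⟨Θ h, hΘ h, rfl⟩, ?_⟩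
    have hmap1 : (P.map fun ω => abstractPath cell κ fun t => (ω t).1).map
        (fun ω => (fun s : Fin (t + 1) => ω s)) = P.map Z' :=
      Measure.map_map (by fun_prop) hg
    have hmap2 : (P.map fun ω => abstractPath cell κ fun t => (ω t).1).map
        (fun ω => (fun s : Fin (t + 1) => ω s, (ω (t + 1)).1)) = P.map fun ω => (Z' ω, V ω) :=
      Measure.map_map (by fun_prop) hg
    rw [hmap1, hmap2, ← compProd_map_condDistrib hV.aemeasurable]
    have hmk : IsMarkovKernel (Kernel.ofFunOfCountable fun h : Fin (t + 1) → Q × Act =>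
        (Θ h).1 (h (Fin.last t)).1) := ⟨fun h => (Θ h).2.isProbabilityMeasure _⟩
    refine Measure.compProd_congr ((ae_iff_of_countable).2 fun h hh => (hΘh h hh).symm)

end Abstraction

/-! ### Soundness of the abstraction -/

theorem mainTheorem1 {n p k : ℕ} {Q Act AP : Type*} [Finite AP]
    [Finite Q] [MeasurableSpace Q] [DiscreteMeasurableSpace Q]
    [Finite Act] [MeasurableSpace Act] [DiscreteMeasurableSpace Act]
    (E : StochasticDifferenceEquation n p k AP) (B : BMDP Q Act AP)
    (α : Set ((Fin n → ℝ) × Q))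
    (Sα : Set (ProbabilityMeasure (Fin n → ℝ) × ProbabilityMeasure Q))
    (hα : IsPartition E.toSystem B.toSystem α)
    (hE : Abstracts E.toSystem B.toSystem α Sα)
    (ν₀ : Measure (Fin n → ℝ)) [IsProbabilityMeasure ν₀]
    (q₀ : Q) (hν₀ : ν₀ {x | (x, q₀) ∈ α} = 1)
    (κ : Policy Q Act) :
    ∃ φ : Policy (Fin n → ℝ) E.U,
      IsImplementation E.toSystem B.toSystem α Sα φ κ ∧
      ∀ P, IsProcessLaw E.toSystem φ ν₀ P →
        ∀ Ψ : Set (ℕ → Set AP), IsOmegaRegular Ψ →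
          MeasurableSet Ψ ∧
          P.real (satEvent E.toSystem Ψ) ∈
            {r : ℝ | ∃ R, IsProcessLaw B.toSystem κ (Measure.dirac q₀) R ∧
              r = R.real (satEvent B.toSystem Ψ)} := by
  classical
  obtain ⟨hcells, hcellm, -⟩ := hα
  choose cell hcell hcell_unique using hcells
  have hα : ∀ x q, (x, q) ∈ α ↔ cell x = q := fun x q =>
    ⟨fun h => (hcell_unique x q h).symm, fun h => h ▸ hcell x⟩
  have hlabel : ∀ x, B.label (cell x) = E.toSystem.label x := by
    intro x
    obtain ⟨q, hq, hl⟩ := hE.1 x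
    rwa [(hα x q).1 hq]
  have hpre : ∀ q, {x | (x, q) ∈ α} = cell ⁻¹' {q} := fun q => Set.ext fun x => hα x q
  have hmeas : Measurable cell := measurable_to_countable' fun q => hpre q ▸ hcellm q
  choose m hm using hE.2
  have hφ := isImplementation_implement (κ := κ) hα hmeas (m := fun z => m z.1 z.2) hm
  refine ⟨_, hφ, fun P hP Ψ hΨ => ⟨hΨ.measurableSet,
    P.map fun ω => abstractPath cell κ fun t => (ω t).1, ?_, ?_⟩⟩
  · refine hP.map_abstractPath hα hmeas hφ (fun a => ?_) (hpre q₀ ▸ hν₀)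
    -- The collection of `a` is nonempty because a process exists: its kernel, at a constant history
    -- with control `m (cell 0) a`, yields a concrete kernel, and matching turns it into an
    -- admissible matrix.
    obtain ⟨-, -, -, hstep⟩ := hP
    obtain ⟨K, hK, -⟩ := hstep 0
    obtain ⟨T, hT, -⟩ := hK fun _ => (0, m (cell 0) a)
    obtain ⟨Θ, hΘ, -⟩ := hm (cell 0) a T hT 0 (hcell 0)
    exact ⟨Θ, hΘ⟩
  · have hg : Measurable fun ω : ℕ → (Fin n → ℝ) × E.U => abstractPath cell κ fun t => (ω t).1 :=
      (measurable_abstractPath hmeas κ).comp (by fun_prop)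
    rw [map_measureReal_apply hg (measurableSet_satEvent _ hΨ.measurableSet),
      preimage_satEvent_abstractPath hlabel]
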